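/- Let $k$ be a natural number and regard $L^2(\mathbb R^k)$ (Lebesgue measure, complex-valued functions) as a complex Hilbert space. For $y\in\mathbb R^k$ let $T_y f(x)=f(x-y)$. A closed subspace $\mathcal V\subseteq L^2(\mathbb R^k)$ is called finitely generated shift invariant (FSI) if there is a finite set $\mathcal A\subset L^2(\mathbb R^k)$ such that $\mathcal V=\overline{\operatorname{span}}\{T_\ell f: f\in\mathcal A,\ \ell\in\mathbb Z^k\}$. Let $\mathcal V,\mathcal W$ be FSI subspaces with $\mathcal V\oplus\mathcal W^\perp=L^2(\mathbb R^k)$, i.e. $\mathcal V\cap\mathcal W^\perp=\{0\}$ and $\mathcal V+\mathcal W^\perp=L^2(\mathbb R^k)$; then also $\mathcal W\oplus\mathcal V^\perp=L^2(\mathbb R^k)$, and $P_{\mathcal W//\mathcal V^\perp}$ denotes the bounded (oblique) projection with range $\mathcal W$ and null space $\mathcal V^\perp$. Let $P_{\mathcal S}$ denote the orthogonal projection onto a closed subspace $\mathcal S$. Define the aliasing norm $$A(\mathcal V,\mathcal W)=\|P_{\mathcal W//\mathcal V^\perp}\,P_{\mathcal W^\perp}\|$$ (operator norm) and the aperture $[\mathcal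 V,\mathcal W]^a\in[0,\pi/2]$ by $$\cos([\mathcal V,\mathcal W]^a)=\inf\{\|P_{\mathcal V}f\|: f\in\mathcal W,\ \|f\|=1\},$$ where the infimum is taken in $[0,1]$, so that it equals $1$ if $\mathcal W=\{0\}$. Then $[\mathcal V,\mathcal W]^a<\pi/2$ and $$A(\mathcal V,\mathcal W)=\tan([\mathcal V,\mathcal W]^a).$$ -/

import Mathlib

open MeasureTheory

noncomputable section

/-! ### Oblique projections, the aliasing norm and the aperture in a complex Hilbert space -/

section Hilbert

variable {H : Type*} [NormedAddCommGroup H] [InnerProductSpace ℂ H] [CompleteSpace H]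

/-- Two closed subspaces `V`, `W` form an oblique pair if `V ⊕ Wᗮ = H`, an algebraic direct sum:
`V ∩ Wᗮ = {0}` and `V + Wᗮ = H` (no closure is taken in the sum). -/
def IsObliquePair (V W : ClosedSubmodule ℂ H) : Prop :=
  IsCompl V.toSubmodule W.toSubmoduleᗮ

/-- If `V ⊕ Wᗮ = H`, then also `W ⊕ Vᗮ = H`, and the corresponding projections are bounded. -/
theorem IsObliquePair.isTopCompl {V W : ClosedSubmodule ℂ H} (h : IsObliquePair V W) :
    Submodule.IsTopCompl W.toSubmodule V.toSubmoduleᗮ := by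
  have hV : IsClosed (V.toSubmodule : Set H) := V.isClosed
  have hW : IsClosed (W.toSubmoduleᗮ : Set H) := W.toSubmodule.isClosed_orthogonal
  have h0 : Submodule.IsTopCompl V.toSubmodule W.toSubmoduleᗮ :=
    Submodule.isTopCompl_iff_isCompl_isClosed.2 ⟨h, hV, hW⟩
  have : CompleteSpace V.toSubmodule := hV.completeSpace_coe
  have : CompleteSpace W.toSubmodule := W.isClosed.completeSpace_coe
  let Q : H →L[ℂ] H := V.toSubmodule.projectionL W.toSubmoduleᗮ h0
  have hQ : IsIdempotentElem Q := by
    ext x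
    simp [Q]
  have hr : Q.range = V.toSubmodule := by simp [Q]
  have hk : Q.ker = W.toSubmoduleᗮ := by simp [Q]
  have hQ' : IsIdempotentElem Q.adjoint := by
    have := hQ.star
    rwa [ContinuousLinearMap.star_eq_adjoint] at this
  have hk' : Q.adjoint.ker = V.toSubmoduleᗮ := by
    rw [← ContinuousLinearMap.orthogonal_range, hr]
  have hr' : Q.adjoint.range = W.toSubmodule := by
    have h1 := Q.orthogonal_ker
    rw [hk, Submodule.orthogonal_orthogonal] at h1
    have h2 : IsClosed (Q.adjoint.range : Set H) :=
      (ContinuousLinearMap.IsIdempotentElem.isTopCompl hQ').isClosed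
    rw [h1, h2.submodule_topologicalClosure_eq]
  have h3 := ContinuousLinearMap.IsIdempotentElem.isTopCompl hQ'
  rwa [hr', hk'] at h3

/-- The bounded oblique projection `P_{W // Vᗮ}` with range `W` and null space `Vᗮ`. -/
def obliqueProjection (V W : ClosedSubmodule ℂ H) (h : IsObliquePair V W) : H →L[ℂ] H :=
  W.toSubmodule.projectionL V.toSubmoduleᗮ h.isTopCompl

/-- The aliasing norm `A(V, W) = ‖P_{W // Vᗮ} P_{Wᗮ}‖` of the consistent sampling
`f ↦ P_{W // Vᗮ} f`. -/
def aliasingNorm (V W : ClosedSubmodule ℂ H) (h : IsObliquePair V W) : ℝ :=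
  ‖(obliqueProjection V W h).comp W.toSubmoduleᗮ.starProjection‖

/-- The infimum `inf {‖P_S f‖ : f ∈ T, ‖f‖ = 1}`, taken in `[0, 1]`: all the norms in question lie
in `[0, 1]`, so adjoining `1` changes nothing except that the infimum is `1` for `T = {0}`. -/
def infCosAngle (S T : ClosedSubmodule ℂ H) : ℝ :=
  sInf (insert 1 {r : ℝ | ∃ f ∈ T, ‖f‖ = 1 ∧ r = ‖S.toSubmodule.starProjection f‖})

/-- The aperture `[S, T]^a ∈ [0, π / 2]`, the angle whose cosine is
`inf {‖P_S f‖ : f ∈ T, ‖f‖ = 1}`. -/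
def aperture (S T : ClosedSubmodule ℂ H) : ℝ :=
  Real.arccos (infCosAngle S T)

end Hilbert

/-! ### Finitely generated shift-invariant subspaces of `L²(ℝᵏ)` -/

/-- The complex Hilbert space `L²(ℝᵏ)` with respect to Lebesgue measure. -/
abbrev L2 (k : ℕ) : Type :=
  Lp ℂ 2 (volume : Measure (EuclideanSpace ℝ (Fin k)))

/-- The integer vector `ℓ ∈ ℤᵏ` seen in `ℝᵏ`. -/
def latticePoint {k : ℕ} (l : Fin k → ℤ) : EuclideanSpace ℝ (Fin k) :=
  WithLp.toLp 2 fun i => (l i : ℝ)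

/-- The translation operator `T_y f (x) = f (x - y)` on `L²(ℝᵏ)`. -/
def translateL2 {k : ℕ} (y : EuclideanSpace ℝ (Fin k)) (f : L2 k) : L2 k :=
  Lp.compMeasurePreserving (fun x => x - y) (measurePreserving_sub_right volume y) f

/-- The closed linear span of `{T_ℓ f : f ∈ A, ℓ ∈ ℤᵏ}`, the shift-invariant subspace generated
by `A`. -/
def shiftInvariantSpan {k : ℕ} (A : Set (L2 k)) : ClosedSubmodule ℂ (L2 k) :=
  (Submodule.span ℂ {g : L2 k | ∃ f ∈ A, ∃ l : Fin k → ℤ, g = translateL2 (latticePoint l) f}).closure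

/-- A finitely generated shift-invariant (FSI) subspace of `L²(ℝᵏ)`. -/
def IsFSI {k : ℕ} (V : ClosedSubmodule ℂ (L2 k)) : Prop :=
  ∃ A : Set (L2 k), A.Finite ∧ V = shiftInvariantSpan A

end

/-! Write `E` for the oblique projection onto `W` along `Vᗮ`, `c` for the cosine of the aperture and
`A` for the aliasing norm; suppose `W ≠ 0`. Both sides are read off from `‖E‖`. Since `E` and `P_V`
both have kernel `Vᗮ`, `E P_V = E` and `P_V E = P_V`. So `E` on `V` inverts `P_V` restricted to `W`,
and `c = ‖E‖⁻¹` (`infCosAngle_eq_inv_norm`). Since `E` fixes `W`, it acts on `W ⊕ Wᗮ` by `w + g ↦ w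
+ E g`, which gives `‖E‖² = 1 + A²` (`norm_obliqueProjection_sq_le`, `one_add_aliasingNorm_sq_le`).
Hence `c² (1 + A²) = 1` with `c > 0`, that is, `A = √(1 - c²) / c`. -/

theorem norm_add_sq_of_mem_orthogonal {H : Type*} [NormedAddCommGroup H]
    [InnerProductSpace ℂ H] {K : Submodule ℂ H} {x y : H} (hx : x ∈ K)
    (hy : y ∈ Kᗮ) : ‖x + y‖ ^ 2 = ‖x‖ ^ 2 + ‖y‖ ^ 2 := by
  simpa [sq] using
    norm_add_sq_eq_norm_sq_add_norm_sq_of_inner_eq_zero (𝕜 := ℂ) x y (hy x hx)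

section ObliqueProjections

variable {H : Type*} [NormedAddCommGroup H] [InnerProductSpace ℂ H] [CompleteSpace H]
  {V W : ClosedSubmodule ℂ H}

theorem obliqueProjection_mem (h : IsObliquePair V W) (x : H) :
    obliqueProjection V W h x ∈ W.toSubmodule := by
  simp [obliqueProjection]

theorem obliqueProjection_apply_mem (h : IsObliquePair V W) {w : H} (hw : w ∈ W.toSubmodule) :
    obliqueProjection V W h w = w := by
  simpa [obliqueProjection] using
    Submodule.projection_apply_of_mem_left h.isTopCompl.isCompl hw

theorem obliqueProjection_eq_zero (h : IsObliquePair V W) {x : H}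
    (hx : x ∈ V.toSubmoduleᗮ) : obliqueProjection V W h x = 0 := by
  simpa [obliqueProjection] using
    Submodule.projection_apply_of_mem_right h.isTopCompl.isCompl hx

theorem sub_obliqueProjection_mem (h : IsObliquePair V W) (x : H) :
    x - obliqueProjection V W h x ∈ V.toSubmoduleᗮ := by
  have h0 : obliqueProjection V W h (x - obliqueProjection V W h x) = 0 := by
    rw [map_sub, obliqueProjection_apply_mem h (obliqueProjection_mem h x), sub_self]
  have hk : (obliqueProjection V W h).ker = V.toSubmoduleᗮ := by simp [obliqueProjection]
  rw [← hk]
  exact h0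

/-- `P_{W // Vᗮ} x = P_{W // Vᗮ} (P_V x)`. -/
theorem obliqueProjection_starProjection (h : IsObliquePair V W) (x : H) :
    obliqueProjection V W h (V.toSubmodule.starProjection x) = obliqueProjection V W h x := by
  have := obliqueProjection_eq_zero h (V.toSubmodule.sub_starProjection_mem_orthogonal x)
  rw [map_sub, sub_eq_zero] at this
  exact this.symm

theorem starProjection_obliqueProjection (h : IsObliquePair V W) (x : H) :
    V.toSubmodule.starProjection (obliqueProjection V W h x) =
      V.toSubmodule.starProjection x := by
  have := (V.toSubmodule.starProjection_apply_eq_zero_iff).2 (sub_obliqueProjection_mem h x)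
  rw [map_sub, sub_eq_zero] at this
  exact this.symm

theorem bddBelow_cosAngles (S T : ClosedSubmodule ℂ H) :
    BddBelow (insert 1 {r : ℝ | ∃ f ∈ T, ‖f‖ = 1 ∧ r = ‖S.toSubmodule.starProjection f‖}) := by
  refine ⟨0, ?_⟩
  rintro r (rfl | ⟨f, -, -, rfl⟩)
  · exact zero_le_one
  · exact norm_nonneg _

theorem infCosAngle_mul_norm_le (S T : ClosedSubmodule ℂ H) {f : H} (hf : f ∈ T) :
    infCosAngle S T * ‖f‖ ≤ ‖S.toSubmodule.starProjection f‖ := by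
  rcases eq_or_ne f 0 with rfl | h0
  · simp
  have hn : 0 < ‖f‖ := norm_pos_iff.2 h0
  have hle : infCosAngle S T ≤
      ‖S.toSubmodule.starProjection (((‖f‖⁻¹ : ℝ) : ℂ) • f)‖ := by
    refine csInf_le (bddBelow_cosAngles S T) (Or.inr ⟨_, T.toSubmodule.smul_mem _ hf, ?_, rfl⟩)
    rw [norm_smul, Complex.norm_real, norm_inv, norm_norm, inv_mul_cancel₀ hn.ne']
  rw [map_smul, norm_smul, Complex.norm_real, norm_inv, norm_norm] at hle
  rwa [← div_eq_inv_mul, le_div_iff₀ hn] at hle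

theorem infCosAngle_bot (S : ClosedSubmodule ℂ H) {T : ClosedSubmodule ℂ H}
    (hT : ∀ f ∈ T, f = 0) : infCosAngle S T = 1 := by
  have : {r : ℝ | ∃ f ∈ T, ‖f‖ = 1 ∧ r = ‖S.toSubmodule.starProjection f‖} = ∅ := by
    refine Set.eq_empty_of_forall_notMem ?_
    rintro r ⟨f, hf, hn, -⟩
    simp [hT f hf] at hn
  rw [infCosAngle, this]
  simp

theorem one_le_norm_obliqueProjection (h : IsObliquePair V W) {w : H} (hw : w ∈ W)
    (h0 : w ≠ 0) : 1 ≤ ‖obliqueProjection V W h‖ := by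
  have := (obliqueProjection V W h).le_opNorm w
  rw [obliqueProjection_apply_mem h hw] at this
  exact le_of_mul_le_mul_right (by simpa using this) (norm_pos_iff.2 h0)

/-- The cosine of the aperture is the inverse of the norm of the oblique projection. -/
theorem infCosAngle_eq_inv_norm (h : IsObliquePair V W) {w : H} (hw : w ∈ W) (h0 : w ≠ 0) :
    infCosAngle V W = ‖obliqueProjection V W h‖⁻¹ := by
  have h1 := one_le_norm_obliqueProjection h hw h0
  have hE : 0 < ‖obliqueProjection V W h‖ := by linarith
  have hle : ‖obliqueProjection V W h‖⁻¹ ≤ infCosAngle V W := by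
    refine le_csInf (Set.insert_nonempty _ _) ?_
    rintro r (rfl | ⟨f, hf, hn, rfl⟩)
    · exact inv_le_one_of_one_le₀ h1
    -- For `f ∈ W`, `f = E f = E (P_V f)`, so `1 = ‖f‖ ≤ ‖E‖ ‖P_V f‖`.
    · have := (obliqueProjection V W h).le_opNorm (V.toSubmodule.starProjection f)
      rw [obliqueProjection_starProjection, obliqueProjection_apply_mem h hf, hn] at this
      exact (inv_le_iff_one_le_mul₀' hE).2 this
  have hc : 0 < infCosAngle V W := (inv_pos.2 hE).trans_le hle
  refine le_antisymm ((le_inv_comm₀ hE hc).1 ?_) hle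
  refine ContinuousLinearMap.opNorm_le_bound _ (inv_nonneg.2 hc.le) fun x => ?_
  rw [← div_eq_inv_mul, le_div_iff₀' hc]
  calc infCosAngle V W * ‖obliqueProjection V W h x‖
      ≤ ‖V.toSubmodule.starProjection (obliqueProjection V W h x)‖ :=
        infCosAngle_mul_norm_le V W (obliqueProjection_mem h x)
    _ = ‖V.toSubmodule.starProjection x‖ := by rw [starProjection_obliqueProjection]
    _ ≤ ‖x‖ := V.toSubmodule.norm_starProjection_apply_le x

/-- Used with `M = ‖E‖²`, `a = ‖E g‖²`, `b = ‖g‖²`. For `M > 1` the choice `s = M - 1` gives the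
bound exactly. -/
theorem le_sub_one_mul_of_forall_quadratic {M a b : ℝ} (hM : 1 ≤ M) (hb : 0 ≤ b)
    (hs : ∀ s : ℝ, (1 + s) ^ 2 * a ≤ M * (a + s ^ 2 * b)) : a ≤ (M - 1) * b := by
  rcases hM.eq_or_lt with rfl | hM
  -- Here `s = M - 1 = 0` says nothing. Instead, for small `s > 0` the linear term `2 s a` beats `s²
  -- b`: `s = a / (b + 1)` makes `s b < a`.
  · by_contra! ha
    have ha : 0 < a := by simpa using ha
    have hpos : 0 < a / (b + 1) := by positivity
    have h2 : a / (b + 1) * (b + 1) = a := div_mul_cancel₀ _ (by positivity)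
    have h1 := hs (a / (b + 1))
    set s := a / (b + 1)
    have h3 : s * (2 * a) ≤ s * (s * b) := by nlinarith [mul_nonneg (sq_nonneg s) ha.le]
    have h4 := le_of_mul_le_mul_left h3 hpos
    linarith
  · have h1 := hs (M - 1)
    have h2 : (M * (M - 1)) * a ≤ (M * (M - 1)) * ((M - 1) * b) := by nlinarith
    exact le_of_mul_le_mul_left h2 (mul_pos (by linarith) (by linarith))

theorem aliasingNorm_nonneg (h : IsObliquePair V W) : 0 ≤ aliasingNorm V W h :=
  norm_nonneg _

theorem norm_obliqueProjection_orthogonal_le (h : IsObliquePair V W) {g : H}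
    (hg : g ∈ W.toSubmoduleᗮ) :
    ‖obliqueProjection V W h g‖ ≤ aliasingNorm V W h * ‖g‖ := by
  have := ((obliqueProjection V W h).comp W.toSubmoduleᗮ.starProjection).le_opNorm g
  rwa [ContinuousLinearMap.comp_apply, Submodule.starProjection_eq_self_iff.2 hg] at this

theorem norm_obliqueProjection_sq_le (h : IsObliquePair V W) :
    ‖obliqueProjection V W h‖ ^ 2 ≤ 1 + aliasingNorm V W h ^ 2 := by
  set β := aliasingNorm V W h with hβ
  have hβ0 : 0 ≤ β := aliasingNorm_nonneg h
  rw [← Real.le_sqrt (norm_nonneg _) (by positivity)]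
  refine ContinuousLinearMap.opNorm_le_bound _ (Real.sqrt_nonneg _) fun x => ?_
  set a := W.toSubmodule.starProjection x
  have ha : a ∈ W.toSubmodule := W.toSubmodule.starProjection_apply_mem x
  have hb : x - a ∈ W.toSubmoduleᗮ := W.toSubmodule.sub_starProjection_mem_orthogonal x
  have hx : ‖x‖ ^ 2 = ‖a‖ ^ 2 + ‖x - a‖ ^ 2 := by
    rw [← norm_add_sq_of_mem_orthogonal ha hb, add_sub_cancel]
  have hE : ‖obliqueProjection V W h x‖ ≤ ‖a‖ + β * ‖x - a‖ := by
    calc ‖obliqueProjection V W h x‖ = ‖a + obliqueProjection V W h (x - a)‖ := by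
          rw [map_sub, obliqueProjection_apply_mem h ha, add_sub_cancel]
      _ ≤ _ := (norm_add_le _ _).trans
          (add_le_add_right (norm_obliqueProjection_orthogonal_le h hb) _)
  refine hE.trans ?_
  rw [← Real.sqrt_sq (norm_nonneg x), ← Real.sqrt_mul (by positivity), hx]
  refine Real.le_sqrt_of_sq_le ?_
  -- Cauchy–Schwarz for `(1, β)` and `(‖a‖, ‖x - a‖)`; the square is its defect.
  linarith [sq_nonneg (β * ‖a‖ - ‖x - a‖)]

/-- For `g ∈ Wᗮ`, test `‖E‖` on the orthogonal sum `E g + s g`, which `E` sends to `(1 + s) E g`,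
and vary `s`. -/
theorem one_add_aliasingNorm_sq_le (h : IsObliquePair V W)
    (h1 : 1 ≤ ‖obliqueProjection V W h‖) :
    1 + aliasingNorm V W h ^ 2 ≤ ‖obliqueProjection V W h‖ ^ 2 := by
  set E := obliqueProjection V W h with hE
  have hM : 1 ≤ ‖E‖ ^ 2 := one_le_pow₀ h1
  suffices aliasingNorm V W h ≤ Real.sqrt (‖E‖ ^ 2 - 1) by
    have := (Real.le_sqrt (aliasingNorm_nonneg h) (by linarith)).1 this
    linarith
  refine ContinuousLinearMap.opNorm_le_bound _ (Real.sqrt_nonneg _) fun x => ?_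
  set g := W.toSubmoduleᗮ.starProjection x with hgx
  have hg : g ∈ W.toSubmoduleᗮ := W.toSubmoduleᗮ.starProjection_apply_mem x
  have hw : E g ∈ W.toSubmodule := obliqueProjection_mem h g
  have hEw : E (E g) = E g := obliqueProjection_apply_mem h hw
  have key : ‖E g‖ ^ 2 ≤ (‖E‖ ^ 2 - 1) * ‖g‖ ^ 2 := by
    refine le_sub_one_mul_of_forall_quadratic hM (sq_nonneg _) fun s => ?_
    have hx : ‖E g + (s : ℂ) • g‖ ^ 2 = ‖E g‖ ^ 2 + s ^ 2 * ‖g‖ ^ 2 := by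
      rw [norm_add_sq_of_mem_orthogonal hw (Submodule.smul_mem _ _ hg), norm_smul, mul_pow,
        Complex.norm_real, Real.norm_eq_abs, sq_abs]
    have hEx : E (E g + (s : ℂ) • g) = ((1 + s : ℝ) : ℂ) • E g := by
      rw [map_add, map_smul, hEw]
      push_cast
      module
    have := pow_le_pow_left₀ (norm_nonneg _) (E.le_opNorm (E g + (s : ℂ) • g)) 2
    rwa [hEx, norm_smul, mul_pow, mul_pow, hx, Complex.norm_real, Real.norm_eq_abs, sq_abs]
      at this
  calc ‖E g‖ ≤ Real.sqrt ((‖E‖ ^ 2 - 1) * ‖g‖ ^ 2) := Real.le_sqrt_of_sq_le key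
    _ = Real.sqrt (‖E‖ ^ 2 - 1) * ‖g‖ := by
        rw [Real.sqrt_mul (by linarith), Real.sqrt_sq (norm_nonneg _)]
    _ ≤ Real.sqrt (‖E‖ ^ 2 - 1) * ‖x‖ := by
        gcongr
        exact W.toSubmoduleᗮ.norm_starProjection_apply_le x

/-- The cosine `c` of the aperture is positive and `c² (1 + A(V, W)²) = 1`. -/
theorem infCosAngle_pos_and_sq_mul (h : IsObliquePair V W) :
    0 < infCosAngle V W ∧ infCosAngle V W ^ 2 * (1 + aliasingNorm V W h ^ 2) = 1 := by
  -- For `W = 0`, `E = 0` and `c = ‖E‖⁻¹` fails; the convention `c = 1` matches `A = 0`.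
  by_cases hW : ∀ w ∈ W, w = 0
  · have hA : aliasingNorm V W h = 0 := by
      rw [aliasingNorm, norm_eq_zero]
      ext x
      exact hW _ (obliqueProjection_mem h _)
    rw [infCosAngle_bot V hW, hA]
    norm_num
  · push Not at hW
    obtain ⟨w, hw, h0⟩ := hW
    have h1 := one_le_norm_obliqueProjection h hw h0
    have hpos : 0 < ‖obliqueProjection V W h‖ := by linarith
    rw [infCosAngle_eq_inv_norm h hw h0,
      (one_add_aliasingNorm_sq_le h h1).antisymm (norm_obliqueProjection_sq_le h), inv_pow]
    exact ⟨inv_pos.2 hpos, inv_mul_cancel₀ (by positivity)⟩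

/-- The aliasing norm is the tangent of the aperture, for oblique pairs in any Hilbert space. -/
theorem aliasingNorm_eq_tan_aperture (h : IsObliquePair V W) :
    aperture V W < Real.pi / 2 ∧ aliasingNorm V W h = Real.tan (aperture V W) := by
  obtain ⟨hc, hsq⟩ := infCosAngle_pos_and_sq_mul h
  refine ⟨Real.arccos_lt_pi_div_two.2 hc, ?_⟩
  have hsub : 1 - infCosAngle V W ^ 2 = (infCosAngle V W * aliasingNorm V W h) ^ 2 := by
    linarith
  rw [aperture, Real.tan_arccos, hsub,
    Real.sqrt_sq (mul_nonneg hc.le (aliasingNorm_nonneg h)), mul_div_cancel_left₀ _ hc.ne']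

end ObliqueProjections

theorem mainTheorem10 {k : ℕ} (V W : ClosedSubmodule ℂ (L2 k)) (hV : IsFSI V) (hW : IsFSI W)
    (h : IsObliquePair V W) :
    aperture V W < Real.pi / 2 ∧ aliasingNorm V W h = Real.tan (aperture V W) :=
  aliasingNorm_eq_tan_aperture h
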